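/- Let $k\ge 1$, let $X$ be a compact metric space on which the additive group $\mathbb{Z}^k$ acts by homeomorphisms, and let $Y\subset X$ be a $\mathbb{Z}^k$-invariant closed subset. Suppose that the complement $X\setminus Y$ has finite topological covering dimension. Then $$\dim(X:\mathbb{Z}^k)=\dim(Y:\mathbb{Z}^k)$$ (as elements of $[0,\infty]$). Here the mean dimension $\dim(X:\mathbb{Z}^k)$ of a compact metric space $(X,d)$ with a $\mathbb{Z}^k$-action by homeomorphisms is defined as follows. For a distance $\rho$ inducing the topology of $X$ and $\varepsilon>0$, $\mathrm{Widim}_\varepsilon(X,\rho)$ is the minimum number $n$ such that there are an $n$-dimensional finite polyhedron $P$ and a continuous map $f:X\to P$ all of whose fibres have $\rho$-diameter at most $\varepsilon$. For a finite subset $\Omega\subset\mathbb{Z}^k$ put $d_\Omega(x,y):=\max_{\gamma\in\Omega}d(\gamma.x,\gamma.y)$, and let $I_n:=[0,n)^k\cap\mathbb{Z}^k$. Then $$\mathrm{Widim}_\varepsilon(X:\mathbb{Z}^k):=\lim_{n\to\infty}\frac1{n^k}\mathrm{Widim}_\varepsilon(X,d_{I_n}),\qquad \dim(X:\mathbb{Z}^k):=\lim_{\varepsilon\downarrow0}\mathrm{Widim}_\varepsilon(X:\mathbb{Z}^k);$$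 the first limit always exists (so it equals the corresponding limit superior), and the second exists because $\mathrm{Widim}_\varepsilon(X:\mathbb{Z}^k)$ is non-decreasing as $\varepsilon\downarrow0$. The set $Y$ carries the restricted distance and action, and $\dim(\emptyset:\mathbb{Z}^k)=0$. -/

import Mathlib

open Filter Topology
open scoped ENNReal NNReal

namespace MeanDimension

/-- The topological (Čech–Lebesgue) covering dimension of `X` is at most `n`: every finite open
cover of `X` has a finite open refinement that covers `X` and no point of `X` lies in more than
`n + 1` of its members. -/
def CoveringDimLE (X : Type*) [TopologicalSpace X] (n : ℕ) : Prop :=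
  ∀ U : Set (Set X), U.Finite → (∀ u ∈ U, IsOpen u) → ⋃₀ U = Set.univ →
    ∃ V : Set (Set X), V.Finite ∧ (∀ v ∈ V, IsOpen v) ∧ ⋃₀ V = Set.univ ∧
      (∀ v ∈ V, ∃ u ∈ U, v ⊆ u) ∧ ∀ x : X, {v ∈ V | x ∈ v}.encard ≤ n + 1

/-- `X` has finite covering dimension. -/
def HasFiniteCoveringDim (X : Type*) [TopologicalSpace X] : Prop :=
  ∃ n : ℕ, CoveringDimLE X n

/-- The dimension of a simplicial complex: the largest dimension of its faces (a face with `m`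
vertices, `m ≥ 1`, has dimension `m - 1`). -/
noncomputable def complexDim {E : Type*} [AddCommGroup E] [Module ℝ E]
    (K : Geometry.SimplicialComplex ℝ E) : ℕ∞ :=
  ⨆ s ∈ K.faces, ((s.card - 1 : ℕ) : ℕ∞)

/-- For a distance function `ρ` compatible with the topology of `X`: `f` is an `ε`-embedding of
`(X, ρ)` if it is continuous and all its fibres have `ρ`-diameter at most `ε`. -/
def IsEpsEmbedding {X P : Type*} [TopologicalSpace X] [TopologicalSpace P]
    (ρ : X → X → ℝ) (ε : ℝ) (f : X → P) : Prop :=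
  Continuous f ∧ ∀ p : P, ∀ x ∈ f ⁻¹' {p}, ∀ y ∈ f ⁻¹' {p}, ρ x y ≤ ε

/-- `Widim_ε (X, ρ)`: the minimum of the dimensions of the finite polyhedra `P` (the underlying
spaces of the finite simplicial complexes in the spaces `ℝ^N`) for which there is an
`ε`-embedding of `(X, ρ)` into `P`. -/
noncomputable def widim (X : Type*) [TopologicalSpace X] (ρ : X → X → ℝ) (ε : ℝ) : ℕ∞ :=
  ⨅ (N : ℕ) (K : Geometry.SimplicialComplex ℝ (EuclideanSpace ℝ (Fin N)))
    (_ : K.faces.Finite) (_ : ∃ f : X → K.space, IsEpsEmbedding ρ ε f), complexDim K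

/-- The box `I_n = [0, n)^k ∩ ℤ^k`. -/
noncomputable def box (k n : ℕ) : Finset (Fin k → ℤ) :=
  Fintype.piFinset fun _ => Finset.Ico 0 (n : ℤ)

section Action

variable (k : ℕ) (X : Type*) [MetricSpace X] [AddAction (Fin k → ℤ) X]

variable {k X} in
/-- The distance `d_Ω (x, y) = max_{γ ∈ Ω} d (γ.x, γ.y)` for a finite subset `Ω` of `ℤ^k`. -/
noncomputable def orbitDist (Ω : Finset (Fin k → ℤ)) (x y : X) : ℝ :=
  (Ω.sup fun γ => nndist (γ +ᵥ x) (γ +ᵥ y) : ℝ≥0)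

/-- `Widim_ε (X : ℤ^k)`, the limit of `n^{-k} Widim_ε (X, d_{I_n})` as `n → ∞`. For a compact
space with a continuous action this limit exists, hence it is the limit superior. -/
noncomputable def meanWidim (ε : ℝ) : ℝ≥0∞ :=
  limsup (fun n : ℕ => ((widim X (orbitDist (box k n)) ε : ℕ∞) : ℝ≥0∞) / (n : ℝ≥0∞) ^ k) atTop

/-- The mean dimension `dim (X : ℤ^k)`, the limit of `Widim_ε (X : ℤ^k)` as `ε ↓ 0`; as
`Widim_ε (X : ℤ^k)` does not decrease when `ε` decreases, this is the supremum
(see `tendsto_meanWidim`). -/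
noncomputable def meanDim : ℝ≥0∞ :=
  ⨆ (ε : ℝ) (_ : 0 < ε), meanWidim k X ε

theorem widim_antitone {Z : Type*} [TopologicalSpace Z] (ρ : Z → Z → ℝ) :
    Antitone (widim Z ρ) := by
  intro a b hab
  refine iInf_mono fun N => iInf_mono fun K => iInf_mono fun _ => iInf_mono' ?_
  rintro ⟨f, hf, h⟩
  exact ⟨⟨f, hf, fun p x hx y hy => (h p x hx y hy).trans hab⟩, le_rfl⟩

theorem meanWidim_antitone : Antitone (meanWidim k X) := by
  intro a b hab
  refine limsup_le_limsup (Eventually.of_forall fun n => ?_)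
  exact ENNReal.div_le_div_right (ENat.toENNReal_le.2 (widim_antitone _ hab)) _

theorem tendsto_meanWidim : Tendsto (meanWidim k X) (𝓝[>] 0) (𝓝 (meanDim k X)) := by
  refine tendsto_order.2 ⟨fun a ha => ?_, fun a ha => ?_⟩
  · obtain ⟨ε, hε⟩ := lt_iSup_iff.1 ha
    obtain ⟨h0, h⟩ := lt_iSup_iff.1 hε
    filter_upwards [Ioc_mem_nhdsGT h0] with δ hδ
    exact h.trans_le (meanWidim_antitone k X hδ.2)
  · filter_upwards [self_mem_nhdsWithin] with δ hδ
    exact (le_iSup₂ (f := fun (ε : ℝ) (_ : 0 < ε) => meanWidim k X ε) δ hδ).trans_lt ha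

end Action

end MeanDimension

/-! Restricting maps gives the inequality for `Y`. For the converse, width dimension is encoded by
finite families of real functions: if at most `D` members vanish at any point, and any two points at
distance at least `ε` get opposite signs from some member, then `Widim_ε ≤ D`
(`widim_le_of_separating`). Zero counts add under unions of families, and families pull back along
the action.

An `ε`-embedding of `(Y, d_{I_n})` into a polyhedron of dimension at most `D` yields a family with
at most `D + 1` zeros per point, separating pairs in a neighbourhood `W` of `Y`
(`exists_separating_near`). Its `(N/n + 1)^k` translates handle pairs whose relevant translates stay
in `W`. The points with a translate outside `W` form a closed set disjoint from `Y`; there the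
covering dimension `m` of the complement supplies a family with at most `m + 1` zeros, whatever the
metric (`exists_separating_of_coveringDimLE`). So this cost is paid once and does not grow with `N`
(`widim_box_le`). Dividing by `N^k` and letting `N → ∞` leaves `(D + 1)/n^k`, and `n → ∞` removes
the `1/n^k`. -/

namespace MeanDimension

/-! ### Maps to polyhedra from partitions of unity -/

/-- The `D`-skeleton of the standard simplex in `ℝ^N`. -/
noncomputable def simplexSkeleton (N D : ℕ) :
    Geometry.SimplicialComplex ℝ (EuclideanSpace ℝ (Fin N)) :=
  open scoped Classical in
  Geometry.SimplicialComplex.ofAffineIndependent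
    { faces := {s | s.Nonempty ∧ s.card ≤ D + 1 ∧
        (s : Set (EuclideanSpace ℝ (Fin N))) ⊆ Set.range (EuclideanSpace.basisFun (Fin N) ℝ)}
      isRelLowerSet_faces := fun s hs =>
        ⟨hs.1, fun t hts ht => ⟨ht, (Finset.card_le_card hts).trans hs.2.1,
          (Finset.coe_subset.2 hts).trans hs.2.2⟩⟩ }
    ((EuclideanSpace.basisFun (Fin N) ℝ).toBasis.linearIndependent.affineIndependent.range.mono <| by
      refine Set.iUnion₂_subset fun s hs => ?_
      simpa using hs.2.2)

theorem mem_faces_simplexSkeleton {N D : ℕ} {s : Finset (EuclideanSpace ℝ (Fin N))} :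
    s ∈ (simplexSkeleton N D).faces ↔ s.Nonempty ∧ s.card ≤ D + 1 ∧
      (s : Set (EuclideanSpace ℝ (Fin N))) ⊆ Set.range (EuclideanSpace.basisFun (Fin N) ℝ) :=
  Iff.rfl

theorem finite_faces_simplexSkeleton (N D : ℕ) : (simplexSkeleton N D).faces.Finite :=
  ((Set.finite_range _).finite_subsets.preimage Finset.coe_injective.injOn).subset
    fun _ hs => hs.2.2

theorem complexDim_simplexSkeleton_le (N D : ℕ) : complexDim (simplexSkeleton N D) ≤ D := by
  refine iSup₂_le fun s hs => ?_
  have := (mem_faces_simplexSkeleton.1 hs).2.1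
  exact_mod_cast (by omega : s.card - 1 ≤ D)

theorem mem_space_simplexSkeleton {N D : ℕ} {w : EuclideanSpace ℝ (Fin N)}
    (h0 : ∀ i, 0 ≤ w i) (h1 : ∑ i, w i = 1) (hD : (Finset.univ.filter fun i => w i ≠ 0).card ≤ D + 1) :
    w ∈ (simplexSkeleton N D).space := by
  classical
  set b := EuclideanSpace.basisFun (Fin N) ℝ
  set J := Finset.univ.filter fun i => w i ≠ 0
  have hsum : ∑ i ∈ J, w i = 1 := by rw [Finset.sum_filter_ne_zero, h1]
  have hw : ∑ i ∈ J, w i • b i = w := by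
    rw [Finset.sum_filter_of_ne (fun i _ h => by rintro h'; simp [h'] at h)]
    conv_rhs => rw [← b.sum_repr w]
    simp [b]
  refine Geometry.SimplicialComplex.mem_space_iff.2 ⟨J.image b, mem_faces_simplexSkeleton.2
    ⟨?_, Finset.card_image_le.trans hD, ?_⟩, ?_⟩
  · refine Finset.Nonempty.image ?_ _
    by_contra h
    simp [Finset.not_nonempty_iff_eq_empty.1 h] at hsum
  · simp only [Finset.coe_image]
    exact Set.image_subset_range _ _
  · have := J.centerMass_mem_convexHull (R := ℝ) (w := fun i => w i) (z := b)
      (s := (J.image b : Finset _)) (fun i _ => h0 i) (by rw [hsum]; exact one_pos)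
      (fun i hi => by simpa using ⟨i, by simpa using hi, rfl⟩)
    rwa [Finset.centerMass_eq_of_sum_1 _ _ hsum, hw] at this

/-- The functions are barycentric coordinates of a map into a skeleton. Points of one fibre share a
nonzero coordinate, hence are close. -/
theorem widim_le_of_partition {X : Type*} [TopologicalSpace X] {ρ : X → X → ℝ} {ε : ℝ} {D : ℕ}
    {ι : Type*} [Fintype ι] (φ : ι → C(X, ℝ)) (h0 : ∀ i x, 0 ≤ φ i x) (h1 : ∀ x, ∑ i, φ i x = 1)
    (hD : ∀ x, {i | φ i x ≠ 0}.encard ≤ D + 1)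
    (hρ : ∀ i x y, φ i x ≠ 0 → φ i y ≠ 0 → ρ x y ≤ ε) : widim X ρ ε ≤ D := by
  classical
  set e := Fintype.equivFin ι
  have hmem (x : X) : WithLp.toLp 2 (fun i => φ (e.symm i) x) ∈
      (simplexSkeleton (Fintype.card ι) D).space := by
    refine mem_space_simplexSkeleton (fun i => h0 _ _) ?_ ?_
    · simpa [h1] using e.symm.sum_comp fun i => φ i x
    · have h : (Finset.univ.filter fun i => φ (e.symm i) x ≠ 0 : Set _).encard ≤ D + 1 :=
        (Set.encard_le_encard_of_injOn (fun i hi => by simpa using hi)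
          e.symm.injective.injOn).trans (hD x)
      rw [Set.encard_coe_eq_coe_finsetCard] at h
      have h' : (Finset.univ.filter fun i => φ (e.symm i) x ≠ 0).card ≤ D + 1 := by
        exact_mod_cast h
      exact h'
  refine iInf_le_of_le (Fintype.card ι) <| iInf_le_of_le (simplexSkeleton _ D) <|
    iInf_le_of_le (finite_faces_simplexSkeleton _ _) <| iInf_le_of_le
    ⟨fun x => ⟨_, hmem x⟩, ?_, ?_⟩ (complexDim_simplexSkeleton_le _ _)
  · refine Continuous.subtype_mk ((PiLp.continuous_toLp 2 _).comp ?_) _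
    fun_prop
  · rintro p x rfl y hy
    have hy' : ∀ i, φ i y = φ i x := fun i => by
      have := congrArg (fun p => p.1 (e i)) (hy : (⟨_, hmem y⟩ : (simplexSkeleton _ D).space) = ⟨_, hmem x⟩)
      simpa using this
    obtain ⟨i, hi⟩ : ∃ i, φ i x ≠ 0 := by
      by_contra! h
      simpa [h] using h1 x
    exact hρ i x y hi (by rwa [hy'])

/-! ### Sign-separating families bound the width dimension -/

theorem exists_uniform_separation {X : Type*} [TopologicalSpace X] [CompactSpace X]
    {ρ : X → X → ℝ} (hρ : Continuous fun p : X × X => ρ p.1 p.2) {ε : ℝ} (F : Finset C(X, ℝ))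
    (hF : ∀ x y, ε ≤ ρ x y → ∃ h ∈ F, h x * h y < 0) :
    ∃ η : ℝ, 0 < η ∧ ∀ x y, ε ≤ ρ x y → ∃ h ∈ F, h x * h y < -η ^ 2 := by
  have hS : IsCompact {p : X × X | ε ≤ ρ p.1 p.2} :=
    (isClosed_le continuous_const hρ).isCompact
  obtain ⟨n, hn⟩ := hS.elim_directed_cover
    (fun n : ℕ => {p : X × X | ∃ h ∈ F, h p.1 * h p.2 < -(1 / ((n : ℝ) + 1)) ^ 2})
    (fun n => by
      have : {p : X × X | ∃ h ∈ F, h p.1 * h p.2 < -(1 / ((n : ℝ) + 1)) ^ 2} =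
          ⋃ h ∈ F, {p : X × X | h p.1 * h p.2 < -(1 / ((n : ℝ) + 1)) ^ 2} := by
        ext; simp
      rw [this]
      exact isOpen_biUnion fun h _ => isOpen_lt (by fun_prop) continuous_const)
    (fun p hp => by
      obtain ⟨h, hF, hlt⟩ := hF _ _ hp
      have ht : Tendsto (fun n : ℕ => -(1 / ((n : ℝ) + 1)) ^ 2) atTop (𝓝 0) := by
        simpa using (tendsto_one_div_add_atTop_nhds_zero_nat (𝕜 := ℝ)).pow 2 |>.neg
      obtain ⟨n, hn⟩ := (ht.eventually (lt_mem_nhds hlt)).exists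
      exact Set.mem_iUnion.2 ⟨n, h, hF, hn⟩)
    (Monotone.directed_le fun a b hab p => by
      rintro ⟨h, hF, hlt⟩
      refine ⟨h, hF, hlt.trans_le (neg_le_neg ?_)⟩
      gcongr)
  exact ⟨1 / ((n : ℝ) + 1), by positivity, fun x y hxy => hn (show (x, y) ∈ _ from hxy)⟩

/-- The open set of points at which the functions with `σ i = 0` are small compared with `η` and
with the other functions, whose signs are given by `σ`. -/
def signCell {X ι : Type*} (h : ι → X → ℝ) (η : ℝ) (σ : ι → SignType) : Set X :=
  {x | (∀ i, σ i = 0 → |h i x| < η) ∧ (∀ i, σ i ≠ 0 → SignType.sign (h i x) = σ i) ∧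
    ∀ i j, σ i = 0 → σ j ≠ 0 → |h i x| < |h j x|}

theorem isOpen_signCell {X ι : Type*} [TopologicalSpace X] [Finite ι] {h : ι → X → ℝ}
    (hc : ∀ i, Continuous (h i)) (η : ℝ) (σ : ι → SignType) : IsOpen (signCell h η σ) := by
  have h2 (i : ι) (hi : σ i ≠ 0) : IsOpen {x | SignType.sign (h i x) = σ i} := by
    rcases hs : σ i with _ | _ | _
    · exact absurd hs hi
    · simpa [sign_eq_neg_one_iff] using isOpen_lt (hc i) continuous_const
    · simpa [sign_eq_one_iff] using isOpen_lt continuous_const (hc i)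
  simp only [signCell, Set.ofPred_and, Set.ofPred_forall]
  refine (isOpen_iInter_of_finite fun i => isOpen_iInter_of_finite fun _ =>
    isOpen_lt (hc i).abs continuous_const).inter
    ((isOpen_iInter_of_finite fun i => isOpen_iInter_of_finite fun hi => h2 i hi).inter
    (isOpen_iInter_of_finite fun i => isOpen_iInter_of_finite fun j =>
      isOpen_iInter_of_finite fun _ => isOpen_iInter_of_finite fun _ =>
        isOpen_lt (hc i).abs (hc j).abs))

/-- Different zero sets of equal size are incomparable: an index zero only for `σ` and one zero only
for `τ` would each have the smaller absolute value at `x`. -/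
theorem eq_of_mem_signCell {X ι : Type*} [Fintype ι] {h : ι → X → ℝ} {η : ℝ}
    {σ τ : ι → SignType} {x : X} (hσ : x ∈ signCell h η σ) (hτ : x ∈ signCell h η τ)
    (hcard : (Finset.univ.filter fun i => σ i = 0).card =
      (Finset.univ.filter fun i => τ i = 0).card) : σ = τ := by
  have key : (Finset.univ.filter fun i => σ i = 0) ⊆ Finset.univ.filter fun i => τ i = 0 := by
    by_contra hns
    have hns' : ¬ (Finset.univ.filter fun i => τ i = 0) ⊆ Finset.univ.filter fun i => σ i = 0 :=
      fun hs => hns (Finset.eq_of_subset_of_card_le hs hcard.le).ge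
    obtain ⟨i, hi, hi'⟩ := Finset.not_subset.1 hns
    obtain ⟨j, hj, hj'⟩ := Finset.not_subset.1 hns'
    simp only [Finset.mem_filter, Finset.mem_univ, true_and] at hi hi' hj hj'
    exact lt_asymm (hσ.2.2 i j hi hj') (hτ.2.2 j i hj hi')
  have heq := Finset.eq_of_subset_of_card_le key hcard.ge
  funext i
  have hi : σ i = 0 ↔ τ i = 0 := by simpa using Finset.ext_iff.1 heq i
  by_cases h0 : σ i = 0
  · rw [h0, hi.1 h0]
  · rw [← hσ.2.1 i h0, hτ.2.1 i (fun h => h0 (hi.2 h))]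

/-- The sign vector of the values at `x` is a cell containing `x`, so cells with at most `D` zeros
cover. Cells sharing a point have distinct zero counts in `{0, …, D}`, so at most `D + 1` of them
meet there. -/
theorem widim_le_of_separating {X : Type*} [TopologicalSpace X] [CompactSpace X] [T2Space X]
    {ρ : X → X → ℝ} (hρ : Continuous fun p : X × X => ρ p.1 p.2) {ε : ℝ} {D : ℕ}
    (F : Finset C(X, ℝ)) (hD : ∀ x, (F.filter fun h => h x = 0).card ≤ D)
    (hF : ∀ x y, ε ≤ ρ x y → ∃ h ∈ F, h x * h y < 0) : widim X ρ ε ≤ D := by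
  classical
  obtain ⟨η, hη, hsep⟩ := exists_uniform_separation hρ F hF
  let h : F → X → ℝ := fun i => i.1
  let z : (F → SignType) → ℕ := fun σ => (Finset.univ.filter fun i => σ i = 0).card
  let ι := {σ : F → SignType // z σ ≤ D}
  obtain ⟨φ, hφ⟩ := PartitionOfUnity.exists_isSubordinate isClosed_univ
    (fun σ : ι => signCell h η σ.1) (fun σ => isOpen_signCell (fun i => i.1.continuous) η σ.1)
    (fun x _ => by
      refine Set.mem_iUnion.2 ⟨⟨fun i => SignType.sign (h i x), ?_⟩, ?_, ?_, ?_⟩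
      · refine le_trans ?_ (hD x)
        refine Finset.card_le_card_of_injOn Subtype.val (fun i hi => ?_) Subtype.val_injective.injOn
        simpa [h, sign_eq_zero_iff] using hi
      · intro i hi
        simpa [sign_eq_zero_iff.1 hi] using hη
      · exact fun i _ => rfl
      · intro i j hi hj
        rw [sign_eq_zero_iff.1 hi, abs_zero]
        exact abs_pos.2 fun hj0 => hj (by simp [hj0]))
  have hmem {i x} (hx : φ i x ≠ 0) : x ∈ signCell h η i.1 := hφ i (subset_tsupport _ hx)
  refine widim_le_of_partition (fun i => φ i) (fun i x => φ.nonneg i x) (fun x => ?_) (fun x => ?_)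
    (fun i x y hx hy => ?_)
  · rw [← finsum_eq_sum_of_fintype]
    exact φ.sum_eq_one (Set.mem_univ x)
  · calc {i | φ i x ≠ 0}.encard ≤ (Set.Iio (D + 1)).encard := by
          refine Set.encard_le_encard_of_injOn (f := fun i : ι => z i.1)
            (fun i _ => Nat.lt_succ_of_le i.2) (fun i hi j hj hij => ?_)
          exact Subtype.ext (eq_of_mem_signCell (hmem hi) (hmem hj) hij)
      _ ≤ D + 1 := by
          rw [← Finset.coe_Iio, Set.encard_coe_eq_coe_finsetCard]; simp
  · by_contra! hlt
    obtain ⟨g, hg, hgs⟩ := hsep x y hlt.le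
    obtain ⟨hx1, hx2, -⟩ := hmem hx
    obtain ⟨hy1, hy2, -⟩ := hmem hy
    -- Within one cell `g` is either smaller than `η` or of constant sign; both contradict `g x * g
    -- y < -η ^ 2`.
    by_cases h0 : i.1 ⟨g, hg⟩ = 0
    · have h1 : |g x| < η := hx1 _ h0
      have h2 : |g y| < η := hy1 _ h0
      have h3 : |g x * g y| < η ^ 2 := by
        rw [abs_mul, sq]
        exact mul_lt_mul'' h1 h2 (abs_nonneg _) (abs_nonneg _)
      exact absurd hgs (not_lt.2 (abs_lt.1 h3).1.le)
    · have h1 : SignType.sign (g x) = SignType.sign (g y) := (hx2 _ h0).trans (hy2 _ h0).symm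
      have h2 : SignType.sign (g x * g y) = -1 := sign_neg (hgs.trans_le (by simp [sq_nonneg]))
      rw [sign_mul, h1] at h2
      rcases hs : SignType.sign (g y) with _ | _ | _ <;> rw [hs] at h2 <;> revert h2 <;> decide

/-! ### Separating families near `Y` from maps to polyhedra -/

/-- Admissible weight vectors form a compact set mapping continuously and bijectively onto the
Hausdorff space `K.space`, so the inverse is continuous. -/
theorem exists_barycentric_coordinates {E : Type*} [AddCommGroup E] [Module ℝ E]
    [TopologicalSpace E] [IsTopologicalAddGroup E] [ContinuousSMul ℝ E] [T2Space E]
    (K : Geometry.SimplicialComplex ℝ E) (hK : K.faces.Finite) :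
    ∃ b : E → K.space → ℝ, (∀ v, Continuous (b v)) ∧ (∀ v p, 0 ≤ b v p) ∧
      (∀ p, ∃ s ∈ K.faces, ∀ v ∉ s, b v p = 0) ∧ ∀ p q, (∀ v, b v p = b v q) → p = q := by
  classical
  let V : Finset E := hK.toFinset.biUnion id
  have hV {s : Finset E} (hs : s ∈ K.faces) : s ⊆ V := fun v hv =>
    Finset.mem_biUnion.2 ⟨s, hK.mem_toFinset.2 hs, hv⟩
  let W (s : Finset E) : Set (E → ℝ) := {w | (∀ v ∉ s, w v = 0) ∧ ∑ v ∈ s, w v = 1}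
  let Z : Set (E → ℝ) := (Set.univ.pi fun _ => Set.Icc 0 1) ∩ ⋃ s ∈ K.faces, W s
  have hW (s : Finset E) : IsClosed (W s) := by
    simp only [W, Set.ofPred_and, Set.ofPred_forall]
    exact (isClosed_iInter fun v => isClosed_iInter fun _ =>
      isClosed_eq (continuous_apply v) continuous_const).inter
      (isClosed_eq (by fun_prop) continuous_const)
  have hZ : CompactSpace Z := isCompact_iff_compactSpace.1 <|
    (isCompact_univ_pi fun _ => isCompact_Icc).inter_right <|
      hK.isClosed_biUnion fun s _ => hW s
  have hψs {s : Finset E} (hs : s ∈ K.faces) {w : E → ℝ} (hw : w ∈ W s) :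
      ∑ v ∈ V, w v • v = ∑ v ∈ s, w v • v :=
    (Finset.sum_subset (hV hs) fun v _ hv => by rw [hw.1 v hv, zero_smul]).symm
  have hconv {s : Finset E} {w : E → ℝ} (h0 : ∀ v, 0 ≤ w v) (hw : w ∈ W s) :
      ∑ v ∈ s, w v • v ∈ convexHull ℝ (s : Set E) :=
    Finset.mem_convexHull'.2 ⟨w, fun v _ => h0 v, hw.2, rfl⟩
  let ψ : Z → K.space := fun w => ⟨∑ v ∈ V, w.1 v • v, by
    obtain ⟨w, h0, hw⟩ := w
    obtain ⟨s, hs, hws⟩ := Set.mem_iUnion₂.1 hw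
    rw [hψs hs hws]
    exact K.convexHull_subset_space hs (hconv (fun v => (h0 v trivial).1) hws)⟩
  have hψc : Continuous ψ := Continuous.subtype_mk (continuous_finsetSum _ fun v _ =>
    ((continuous_apply v).comp continuous_subtype_val).smul continuous_const) _
  have huniq {s : Finset E} (hs : s ∈ K.faces) {w u : E → ℝ} (hw : w ∈ W s) (hu : u ∈ W s)
      (h : ∑ v ∈ s, w v • v = ∑ v ∈ s, u v • v) : w = u := by
    funext v
    by_cases hv : v ∈ s
    · exact (K.indep hs).eq_of_sum_eq_sum_subtype (hw.2.trans hu.2.symm) h v hv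
    · rw [hw.1 v hv, hu.1 v hv]
  have hψi : Function.Injective ψ := by
    rintro ⟨w, h0, hw⟩ ⟨u, h0', hu⟩ h
    obtain ⟨s, hs, hws⟩ := Set.mem_iUnion₂.1 hw
    obtain ⟨t, ht, hut⟩ := Set.mem_iUnion₂.1 hu
    have h : ∑ v ∈ V, w v • v = ∑ v ∈ V, u v • v := congrArg Subtype.val h
    rw [hψs hs hws, hψs ht hut] at h
    -- The common image lies in the hull of `s ∩ t`; its weights there, extended by zero, agree with
    -- both `w` and `u` by affine independence.
    have hmem := K.inter_subset_convexHull hs ht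
      ⟨hconv (fun v => (h0 v trivial).1) hws, h ▸ hconv (fun v => (h0' v trivial).1) hut⟩
    rw [← Finset.coe_inter, Finset.mem_convexHull'] at hmem
    obtain ⟨r, -, hr1, hr⟩ := hmem
    let r' : E → ℝ := fun v => if v ∈ s ∩ t then r v else 0
    have aux {a : Finset E} (ha : s ∩ t ⊆ a) :
        r' ∈ W a ∧ ∑ v ∈ a, r' v • v = ∑ v ∈ s ∩ t, r v • v := by
      refine ⟨⟨fun v hv => if_neg fun h => hv (ha h), ?_⟩, ?_⟩
      · rw [← Finset.sum_subset ha fun v _ hv => if_neg hv, ← hr1]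
        exact Finset.sum_congr rfl fun v hv => if_pos hv
      · rw [← Finset.sum_subset ha fun v _ hv => by simp only [r', if_neg hv, zero_smul]]
        exact Finset.sum_congr rfl fun v hv => by simp only [r', if_pos hv]
    obtain ⟨hs1, hs2⟩ := aux Finset.inter_subset_left
    obtain ⟨ht1, ht2⟩ := aux Finset.inter_subset_right
    have e1 := huniq hs hws hs1 (by rw [hs2, hr])
    have e2 := huniq ht hut ht1 (by rw [ht2, hr, h])
    exact Subtype.ext (e1.trans e2.symm)
  have hψsurj : Function.Surjective ψ := by
    rintro ⟨x, hx⟩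
    obtain ⟨s, hs, hxs⟩ := Geometry.SimplicialComplex.mem_space_iff.1 hx
    obtain ⟨r, hr0, hr1, hr⟩ := Finset.mem_convexHull'.1 hxs
    let w : E → ℝ := fun v => if v ∈ s then r v else 0
    have hws : w ∈ W s := ⟨fun v hv => if_neg hv, by
      rw [← hr1]; exact Finset.sum_congr rfl fun v hv => if_pos hv⟩
    have h0 (v : E) : 0 ≤ w v := by
      by_cases hv : v ∈ s
      · simpa [w, hv] using hr0 v hv
      · simp [w, hv]
    refine ⟨⟨w, fun v _ => ⟨h0 v, ?_⟩, Set.mem_iUnion₂.2 ⟨s, hs, hws⟩⟩, Subtype.ext ?_⟩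
    · by_cases hv : v ∈ s
      · exact hws.2 ▸ Finset.single_le_sum (fun v _ => h0 v) hv
      · rw [hws.1 v hv]; exact zero_le_one
    · change ∑ v ∈ V, w v • v = x
      rw [hψs hs hws, ← hr]
      exact Finset.sum_congr rfl fun v hv => by simp only [w, if_pos hv]
  let e := Equiv.ofBijective ψ ⟨hψi, hψsurj⟩
  let Φ : Z ≃ₜ K.space := Continuous.homeoOfEquivCompactToT2 (f := e) hψc
  refine ⟨fun v p => (Φ.symm p).1 v, fun v => ?_, fun v p => ((Φ.symm p).2.1 v trivial).1,
    fun p => ?_, fun p q h => Φ.symm.injective (Subtype.ext (funext h))⟩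
  · exact (continuous_apply v).comp (continuous_subtype_val.comp Φ.symm.continuous)
  · obtain ⟨s, hs, hws⟩ := Set.mem_iUnion₂.1 (Φ.symm p).2.2
    exact ⟨s, hs, hws.1⟩

/-- After an arbitrary extension, subtract (truncating at zero) the `(m + 1)`-st largest value `q`.
It vanishes on `Y`, and at most `m` functions exceed it anywhere. -/
theorem exists_extension_card_ne_zero_le {X α : Type*} [TopologicalSpace X] [NormalSpace X]
    {Y : Set X} (hY : IsClosed Y) (V : Finset α) (m : ℕ) (b : α → C(Y, ℝ≥0))
    (hb : ∀ y, (V.filter fun v => b v y ≠ 0).card ≤ m) :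
    ∃ β : α → C(X, ℝ≥0), (∀ v, ∀ y : Y, β v y = b v y) ∧
      ∀ x, (V.filter fun v => β v x ≠ 0).card ≤ m := by
  classical
  choose β hβ using fun v => ContinuousMap.exists_restrict_eq hY (b v)
  replace hβ (v : α) (y : Y) : β v y = b v y := DFunLike.congr_fun (hβ v) y
  let 𝒥 : Finset (Finset α) := V.powerset.filter fun J => J.card ≤ m
  have h𝒥 : 𝒥.Nonempty := ⟨∅, by simp [𝒥]⟩
  let q : X → ℝ≥0 := fun x => 𝒥.inf' h𝒥 fun J => (V \ J).sup fun v => β v x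
  have hq : Continuous q := Continuous.finset_inf'_apply _ fun J _ =>
    Continuous.finset_sup_apply fun v _ => (β v).continuous
  refine ⟨fun v => ⟨fun x => β v x - q x, by fun_prop⟩, fun v y => ?_, fun x => ?_⟩
  · have : q y = 0 := by
      refine le_antisymm ((Finset.inf'_le (b := V.filter fun v => b v y ≠ 0) _ ?_).trans ?_) bot_le
      · simpa [𝒥] using hb y
      · refine Finset.sup_le fun v hv => ?_
        have : b v y = 0 := by simpa [(Finset.mem_sdiff.1 hv).1] using (Finset.mem_sdiff.1 hv).2
        rw [hβ, this]
    simp [this, hβ]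
  · obtain ⟨J, hJ, hJq⟩ := Finset.exists_mem_eq_inf' h𝒥 fun J => (V \ J).sup fun v => β v x
    refine (Finset.card_le_card fun v hv => ?_).trans (Finset.mem_filter.1 hJ).2
    by_contra hvJ
    have hle : β v x ≤ q x := by
      change _ ≤ 𝒥.inf' _ _
      rw [hJq]
      exact Finset.le_sup (f := fun v => β v x) (Finset.mem_sdiff.2 ⟨(Finset.mem_filter.1 hv).1, hvJ⟩)
    exact (Finset.mem_filter.1 hv).2 (tsub_eq_zero_of_le hle)

/-- Points of `Y` at distance at least `ε` differ in some coordinate, so a positive threshold `t`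
lies between their values and `β v - t` separates them. Finitely many thresholds suffice by
compactness. At a given point each nonzero coordinate meets at most one threshold. -/
theorem exists_separating_near {X : Type*} [TopologicalSpace X] [CompactSpace X] [T2Space X]
    {ρ : X → X → ℝ} (hρ : Continuous fun p : X × X => ρ p.1 p.2) {ε : ℝ} {D : ℕ}
    {Y : Set X} (hY : IsClosed Y) {E : Type*} [AddCommGroup E] [Module ℝ E]
    [TopologicalSpace E] [IsTopologicalAddGroup E] [ContinuousSMul ℝ E] [T2Space E]
    (K : Geometry.SimplicialComplex ℝ E) (hK : K.faces.Finite) (hD : complexDim K ≤ D)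
    {f : Y → K.space} (hf : Continuous f) (hfib : ∀ x y : Y, f x = f y → ρ x y < ε) :
    ∃ (F : Finset C(X, ℝ)) (W : Set X), IsOpen W ∧ Y ⊆ W ∧
      (∀ x, (F.filter fun h => h x = 0).card ≤ D + 1) ∧
      ∀ x ∈ W, ∀ y ∈ W, ε ≤ ρ x y → ∃ h ∈ F, h x * h y < 0 := by
  classical
  obtain ⟨b, hbc, hb0, hbs, hbi⟩ := exists_barycentric_coordinates K hK
  let V : Finset E := hK.toFinset.biUnion id
  have hcard {s : Finset E} (hs : s ∈ K.faces) : s.card ≤ D + 1 := by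
    have h1 : ((s.card - 1 : ℕ) : ℕ∞) ≤ D :=
      (le_iSup₂ (f := fun (s : Finset E) (_ : s ∈ K.faces) => ((s.card - 1 : ℕ) : ℕ∞)) s hs).trans hD
    have h2 : s.card - 1 ≤ D := by exact_mod_cast h1
    omega
  obtain ⟨β, hβ, hβV⟩ := exists_extension_card_ne_zero_le hY V (D + 1)
    (fun v => ⟨fun y => ⟨b v (f y), hb0 _ _⟩, ((hbc v).comp hf).subtype_mk _⟩) (fun y => by
      obtain ⟨s, hs, hsb⟩ := hbs (f y)
      refine (Finset.card_le_card fun v hv => ?_).trans (hcard hs)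
      by_contra hvs
      exact (Finset.mem_filter.1 hv).2 (NNReal.eq (hsb v hvs)))
  have hβ (v : E) (y : Y) : (β v y : ℝ) = b v (f y) := by rw [hβ]; rfl
  let g (i : V × {t : ℝ // 0 < t}) : C(X, ℝ) := ⟨fun x => β i.1 x - i.2, by fun_prop⟩
  let O (i : V × {t : ℝ // 0 < t}) : Set (X × X) := {p | g i p.1 * g i p.2 < 0}
  have hO (i) : IsOpen (O i) := isOpen_lt (by fun_prop) continuous_const
  have hS : IsCompact ((Y ×ˢ Y) ∩ {p : X × X | ε ≤ ρ p.1 p.2}) :=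
    ((hY.prod hY).inter (isClosed_le continuous_const hρ)).isCompact
  obtain ⟨T, hT⟩ := hS.elim_finite_subcover O hO (by
    rintro ⟨x, y⟩ ⟨⟨hx, hy⟩, hxy⟩
    obtain ⟨v, hv⟩ : ∃ v, b v (f ⟨x, hx⟩) ≠ b v (f ⟨y, hy⟩) := by
      by_contra! h
      exact (hfib _ _ (hbi _ _ h)).not_ge hxy
    have hvV : v ∈ V := by
      by_contra hvV
      have h0 (p : K.space) : b v p = 0 := by
        obtain ⟨s, hs, hsb⟩ := hbs p
        exact hsb v fun hvs => hvV (Finset.mem_biUnion.2 ⟨s, hK.mem_toFinset.2 hs, hvs⟩)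
      exact hv (by rw [h0, h0])
    rw [← hβ, ← hβ] at hv
    refine Set.mem_iUnion.2 ?_
    rcases hv.lt_or_gt with hlt | hlt
    · obtain ⟨t, h1, h2⟩ := exists_between hlt
      exact ⟨(⟨v, hvV⟩, ⟨t, (NNReal.coe_nonneg _).trans_lt h1⟩),
        mul_neg_of_neg_of_pos (sub_neg.2 h1) (sub_pos.2 h2)⟩
    · obtain ⟨t, h1, h2⟩ := exists_between hlt
      exact ⟨(⟨v, hvV⟩, ⟨t, (NNReal.coe_nonneg _).trans_lt h1⟩),
        mul_neg_of_pos_of_neg (sub_pos.2 h2) (sub_neg.2 h1)⟩)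
  obtain ⟨U₁, U₂, hU₁, hU₂, hY₁, hY₂, hU⟩ := generalized_tube_lemma hY.isCompact hY.isCompact
    (n := {p : X × X | ρ p.1 p.2 < ε} ∪ ⋃ i ∈ T, O i)
    ((isOpen_lt hρ continuous_const).union (isOpen_biUnion fun i _ => hO i))
    (fun p hp => by
      by_cases hlt : ρ p.1 p.2 < ε
      · exact Or.inl hlt
      · exact Or.inr (hT ⟨hp, not_lt.1 hlt⟩))
  refine ⟨T.image g, U₁ ∩ U₂, hU₁.inter hU₂, Set.subset_inter hY₁ hY₂, fun x => ?_,
    fun x hx y hy hxy => ?_⟩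
  · rw [Finset.filter_image]
    refine Finset.card_image_le.trans (le_trans ?_ (hβV x))
    have hz {i} (hi : i ∈ T.filter fun i => g i x = 0) : (β i.1 x : ℝ) = i.2 :=
      sub_eq_zero.1 (Finset.mem_filter.1 hi).2
    refine Finset.card_le_card_of_injOn (fun i => (i.1 : E)) (fun i hi => ?_)
      fun i hi j hj hij => ?_
    · refine Finset.mem_coe.2 (Finset.mem_filter.2 ⟨i.1.2, fun h0 => i.2.2.ne' ?_⟩)
      rw [← hz hi, h0, NNReal.coe_zero]
    · have hij' : i.1 = j.1 := Subtype.ext hij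
      exact Prod.ext hij' (Subtype.ext (by rw [← hz hi, ← hz hj, hij']))
  · rcases hU (show (x, y) ∈ U₁ ×ˢ U₂ from ⟨hx.1, hy.2⟩) with h | h
    · exact absurd hxy (not_le.2 h)
    · obtain ⟨i, hi, hlt⟩ := Set.mem_iUnion₂.1 h
      exact ⟨g i, Finset.mem_image_of_mem g hi, hlt⟩

/-! ### Separating families from finite covering dimension -/

theorem exists_separating_of_coveringDimLE {X : Type*} [TopologicalSpace X] [CompactSpace X]
    [T2Space X] {ρ : X → X → ℝ} (hρ : Continuous fun p : X × X => ρ p.1 p.2) {ε : ℝ}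
    (hε : ∀ x, ρ x x < ε) {m : ℕ} {Z C : Set X} (hZ : IsOpen Z) (hm : CoveringDimLE Z m)
    (hC : IsClosed C) (hCZ : C ⊆ Z) :
    ∃ F : Finset C(X, ℝ), (∀ x, (F.filter fun h => h x = 0).card ≤ m + 1) ∧
      ∀ x ∈ C, ∀ y, ε ≤ ρ x y → ∃ h ∈ F, h x * h y < 0 := by
  classical
  have hnhds (x : X) : ∃ B : Set X, IsOpen B ∧ x ∈ B ∧ ∀ y ∈ B, ∀ z ∈ B, ρ y z < ε := by
    have : {p : X × X | ρ p.1 p.2 < ε} ∈ 𝓝 (x, x) :=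
      (isOpen_lt hρ continuous_const).mem_nhds (hε x)
    rw [nhds_prod_eq] at this
    obtain ⟨t, ht, hts⟩ := mem_prod_self_iff.1 this
    obtain ⟨B, hBt, hB, hxB⟩ := mem_nhds_iff.1 ht
    refine ⟨B, hB, hxB, fun y hy z hz => ?_⟩
    have hyz : (y, z) ∈ {p : X × X | ρ p.1 p.2 < ε} := hts ⟨hBt hy, hBt hz⟩
    exact hyz
  choose B hB hxB hBρ using hnhds
  obtain ⟨t, ht⟩ := hC.isCompact.elim_finite_subcover B hB
    fun x _ => Set.mem_iUnion.2 ⟨x, hxB x⟩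
  obtain ⟨V, hVf, hVo, hVu, hVr, hVm⟩ := hm
    (insert (Subtype.val ⁻¹' Cᶜ) ((fun x => Subtype.val ⁻¹' B x) '' (t : Set X)))
    ((t.finite_toSet.image _).insert _) (by
      rintro u (rfl | ⟨x, -, rfl⟩)
      · exact hC.isOpen_compl.preimage continuous_subtype_val
      · exact (hB x).preimage continuous_subtype_val) (by
      refine Set.eq_univ_of_forall fun z => ?_
      by_cases hz : z.1 ∈ C
      · obtain ⟨x, hx, hzx⟩ := Set.mem_iUnion₂.1 (ht hz)
        exact ⟨_, Or.inr ⟨x, hx, rfl⟩, hzx⟩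
      · exact ⟨_, Or.inl rfl, hz⟩)
  let ι := {v : Set Z // v ∈ V ∧ ∃ x, v ⊆ Subtype.val ⁻¹' B x}
  have : Finite ι := (hVf.subset fun v (hv : v ∈ V ∧ ∃ x, v ⊆ Subtype.val ⁻¹' B x) => hv.1).to_subtype
  have := Fintype.ofFinite ι
  obtain ⟨φ, hφ⟩ := PartitionOfUnity.exists_isSubordinate hC
    (fun v : ι => Subtype.val '' v.1) (fun v => hZ.isOpenMap_subtype_val _ (hVo _ v.2.1)) (by
      intro x hx
      obtain ⟨v, hv, hxv⟩ := (hVu ▸ Set.mem_univ (⟨x, hCZ hx⟩ : Z) : _ ∈ ⋃₀ V)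
      obtain ⟨u, hu | ⟨y, -, hu⟩, hvu⟩ := hVr v hv
      · subst hu
        exact absurd hx (hvu hxv)
      · subst hu
        exact Set.mem_iUnion.2 ⟨⟨v, hv, y, hvu⟩, _, hxv, rfl⟩)
  have hmem {i x} (hx : φ i x ≠ 0) : x ∈ Subtype.val '' i.1 := hφ i (subset_tsupport _ hx)
  -- Below the average of the `φ i` on `C`, so some `φ i` exceeds `c` there; positive, so zeros of
  -- `φ i - c` lie in the `i`-th member of the cover.
  let c : ℝ := 1 / (Fintype.card ι + 1)
  have hc : 0 < c := by positivity
  let g (i : ι) : C(X, ℝ) := ⟨fun x => φ i x - c, by fun_prop⟩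
  refine ⟨Finset.univ.image g, fun x => ?_, fun x hx y hxy => ?_⟩
  · rw [Finset.filter_image]
    refine Finset.card_image_le.trans ?_
    have hz {i} (hi : i ∈ Finset.univ.filter fun i => g i x = 0) : φ i x ≠ 0 := by
      rw [sub_eq_zero.1 (Finset.mem_filter.1 hi).2]
      exact hc.ne'
    by_cases hxZ : x ∈ Z
    · have h : ((Finset.univ.filter fun i => g i x = 0 : Finset ι) : Set ι).encard ≤ m + 1 := by
        refine (Set.encard_le_encard_of_injOn (f := Subtype.val)
          (t := {v ∈ V | (⟨x, hxZ⟩ : Z) ∈ v}) (fun i hi => ⟨i.2.1, ?_⟩)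
          Subtype.val_injective.injOn).trans (hVm ⟨x, hxZ⟩)
        obtain ⟨z, hz, hzx⟩ := hmem (hz hi)
        exact (Subtype.ext hzx : z = ⟨x, hxZ⟩) ▸ hz
      rw [Set.encard_coe_eq_coe_finsetCard] at h
      exact_mod_cast h
    · rw [Finset.card_eq_zero.2]
      · omega
      · refine Finset.eq_empty_of_forall_notMem fun i hi => hxZ ?_
        obtain ⟨z, -, rfl⟩ := hmem (hz hi)
        exact z.2
  · obtain ⟨i, hi⟩ : ∃ i, c < φ i x := by
      by_contra! h
      have h1 := φ.sum_eq_one hx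
      rw [finsum_eq_sum_of_fintype] at h1
      have h2 : ∑ i, φ i x ≤ Fintype.card ι * c := by
        simpa using Finset.sum_le_card_nsmul Finset.univ (fun i => φ i x) c fun i _ => h i
      have h3 : Fintype.card ι * c < 1 := by
        rw [mul_one_div, div_lt_one (by positivity)]
        linarith
      linarith
    refine ⟨g i, Finset.mem_image_of_mem g (Finset.mem_univ i), ?_⟩
    refine mul_neg_of_pos_of_neg (sub_pos.2 hi) (sub_neg.2 ?_)
    by_contra! hy
    obtain ⟨z, hz, rfl⟩ := hmem (hc.trans hi).ne'
    obtain ⟨z', hz', rfl⟩ := hmem (hc.trans_le hy).ne'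
    obtain ⟨x, hx⟩ := i.2.2
    exact (hBρ x _ (hx hz) _ (hx hz')).not_ge hxy

/-! ### Orbit metrics, tiling of boxes and the limits -/

theorem natCast_div_pow_le_ofReal {k N n D m : ℕ} (hN : 0 < N) :
    (((N / n + 1) ^ k * (D + 1) + (m + 1) : ℕ) : ℝ≥0∞) / (N : ℝ≥0∞) ^ k ≤
      ENNReal.ofReal ((1 / (n : ℝ) + 1 / N) ^ k * (D + 1) + (1 / (N : ℝ)) ^ k * (m + 1)) := by
  have hN' : (0 : ℝ) < N := by exact_mod_cast hN
  rw [← ENNReal.ofReal_natCast, ← ENNReal.ofReal_natCast N, ← ENNReal.ofReal_pow hN'.le,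
    ← ENNReal.ofReal_div_of_pos (by positivity)]
  refine ENNReal.ofReal_le_ofReal ?_
  push_cast
  rw [add_div, mul_div_right_comm, div_eq_inv_mul ((m : ℝ) + 1), ← div_pow, ← inv_pow, one_div (N : ℝ)]
  gcongr
  rw [add_div, ← one_div (N : ℝ)]
  refine add_le_add ?_ le_rfl
  rw [div_le_iff₀ hN', one_div, ← div_eq_inv_mul]
  exact Nat.cast_div_le

section

variable {k : ℕ} {X : Type*} [MetricSpace X] [AddAction (Fin k → ℤ) X]

theorem continuous_orbitDist [ContinuousConstVAdd (Fin k → ℤ) X] (Ω : Finset (Fin k → ℤ)) :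
    Continuous fun p : X × X => orbitDist Ω p.1 p.2 :=
  NNReal.continuous_coe.comp <| Continuous.finset_sup_apply fun γ _ =>
    (continuous_fst.const_vadd γ).nndist (continuous_snd.const_vadd γ)

theorem orbitDist_lt_iff {Ω : Finset (Fin k → ℤ)} {x y : X} {ε : ℝ} (hε : 0 < ε) :
    orbitDist Ω x y < ε ↔ ∀ γ ∈ Ω, dist (γ +ᵥ x) (γ +ᵥ y) < ε := by
  lift ε to ℝ≥0 using hε.le
  rw [orbitDist, NNReal.coe_lt_coe, Finset.sup_lt_iff (by exact_mod_cast hε)]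
  exact forall₂_congr fun γ _ => by rw [← NNReal.coe_lt_coe, coe_nndist]

theorem orbitDist_self (Ω : Finset (Fin k → ℤ)) (x : X) : orbitDist Ω x x = 0 := by
  simp [orbitDist]

theorem exists_sub_mem_box {N n : ℕ} (hn : 0 < n) {γ : Fin k → ℤ} (hγ : γ ∈ box k N) :
    ∃ c ∈ Fintype.piFinset fun _ : Fin k => Finset.range (N / n + 1),
      (γ - fun i => (n : ℤ) * (c i : ℕ)) ∈ box k n := by
  have hn' : (0 : ℤ) < n := by exact_mod_cast hn
  simp only [box, Fintype.mem_piFinset, Finset.mem_Ico] at hγ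
  have h0 (i : Fin k) : 0 ≤ γ i / n := Int.ediv_nonneg (hγ i).1 hn'.le
  refine ⟨fun i => (γ i / n).toNat, ?_, ?_⟩
  · refine Fintype.mem_piFinset.2 fun i => Finset.mem_range.2 (Nat.lt_succ_of_le ?_)
    have : γ i / n ≤ (N : ℤ) / n := Int.ediv_le_ediv hn' (hγ i).2.le
    rw [Int.toNat_le]
    exact_mod_cast this
  · simp only [box, Fintype.mem_piFinset, Finset.mem_Ico, Pi.sub_apply, Int.toNat_of_nonneg (h0 _)]
    intro i
    have h1 := Int.emod_nonneg (γ i) hn'.ne'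
    have h2 := Int.emod_lt_of_pos (γ i) hn'
    have h3 := Int.emod_add_mul_ediv (γ i) n
    constructor <;> linarith

theorem meanWidim_subAddAction_le (Y : SubAddAction (Fin k → ℤ) X) (ε : ℝ) :
    meanWidim k Y ε ≤ meanWidim k X ε := by
  refine limsup_le_limsup (Eventually.of_forall fun n =>
    ENNReal.div_le_div_right (ENat.toENNReal_le.2 ?_) _)
  refine iInf_mono fun N => iInf_mono fun K => iInf_mono fun _ => iInf_mono' ?_
  rintro ⟨f, hf, h⟩
  exact ⟨⟨fun y => f y, hf.comp continuous_subtype_val, fun p x hx y hy => h p x hx y hy⟩, le_rfl⟩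

variable [CompactSpace X] [ContinuousConstVAdd (Fin k → ℤ) X]

theorem widim_box_le (Y : SubAddAction (Fin k → ℤ) X) (hY : IsClosed (Y : Set X)) {m : ℕ}
    (hm : CoveringDimLE ↥((Y : Set X)ᶜ) m) {ε : ℝ} (hε : 0 < ε) {n : ℕ} (hn : 0 < n) {D : ℕ}
    (hD : widim Y (orbitDist (box k n)) ε ≤ D) (N : ℕ) :
    widim X (orbitDist (box k N)) (2 * ε) ≤ (((N / n + 1) ^ k * (D + 1) + (m + 1) : ℕ) : ℕ∞) := by
  classical
  have h2ε : 0 < 2 * ε := by positivity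
  -- A strict bound on the infimum produces an actual complex and map.
  have hD' : widim Y (orbitDist (box k n)) ε < (D : ℕ∞) + 1 :=
    (ENat.lt_add_one_iff (ENat.natCast_ne_top D)).2 hD
  simp only [widim, iInf_lt_iff] at hD'
  obtain ⟨M, K, hK, ⟨f, hf, hfib⟩, hKD⟩ := hD'
  obtain ⟨F, W, hW, hYW, hFD, hFW⟩ := exists_separating_near
    (continuous_orbitDist (X := X) (box k n)) (ε := 2 * ε) hY K hK
    -- Doubling `ε` turns the fibre bound `≤ ε` into the strict bound needed here.
    ((ENat.lt_add_one_iff (ENat.natCast_ne_top D)).1 hKD) hf (fun x y hxy => by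
      have h : orbitDist (box k n) (x : X) y ≤ ε := hfib (f y) x hxy y rfl
      linarith)
  let S := Fintype.piFinset fun _ : Fin k => Finset.range (N / n + 1)
  let s (c : Fin k → ℕ) : Fin k → ℤ := fun i => (n : ℤ) * (c i : ℕ)
  -- Closed, and disjoint from `Y` because `Y` is invariant and contained in `W`.
  let C : Set X := ⋃ c ∈ S, (s c +ᵥ ·) ⁻¹' Wᶜ
  have hC : IsClosed C := S.finite_toSet.isClosed_biUnion fun c _ =>
    hW.isClosed_compl.preimage (continuous_const_vadd _)
  have hCY : C ⊆ (Y : Set X)ᶜ := by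
    intro x hx hxY
    obtain ⟨c, -, hc⟩ := Set.mem_iUnion₂.1 hx
    exact hc (hYW (Y.vadd_mem _ hxY))
  obtain ⟨G, hGm, hGC⟩ := exists_separating_of_coveringDimLE
    (continuous_orbitDist (X := X) (box k N)) (ε := 2 * ε)
    (fun x => by rwa [orbitDist_self]) hY.isOpen_compl hm hC hCY
  let τ (c : Fin k → ℕ) : C(X, X) := ⟨(s c +ᵥ ·), continuous_const_vadd _⟩
  refine widim_le_of_separating (continuous_orbitDist _)
    ((S.biUnion fun c => F.image fun h => h.comp (τ c)) ∪ G) (fun x => ?_) (fun x y hxy => ?_)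
  · rw [Finset.filter_union]
    refine (Finset.card_union_le _ _).trans (Nat.add_le_add ?_ (hGm x))
    rw [Finset.filter_biUnion]
    refine (Finset.card_biUnion_le_card_mul _ _ (D + 1) fun c _ => ?_).trans_eq ?_
    · rw [Finset.filter_image]
      exact Finset.card_image_le.trans (hFD (τ c x))
    · simp [S]
  · by_cases hx : x ∈ C
    · obtain ⟨h, hh, hlt⟩ := hGC x hx y hxy
      exact ⟨h, Finset.mem_union_right _ hh, hlt⟩
    by_cases hy : y ∈ C
    · obtain ⟨h, hh, hlt⟩ := hGC y hy x (hxy.trans_eq (by simp only [orbitDist, nndist_comm]))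
      exact ⟨h, Finset.mem_union_right _ hh, by rwa [mul_comm]⟩
    obtain ⟨γ, hγ, hγd⟩ : ∃ γ ∈ box k N, 2 * ε ≤ dist (γ +ᵥ x) (γ +ᵥ y) := by
      by_contra! h
      exact ((orbitDist_lt_iff h2ε).2 h).not_ge hxy
    -- Some tile `s c + I_n` contains `γ`, so the `s c`-translates of `x` and `y` are already far
    -- apart in `d_{I_n}`.
    obtain ⟨c, hc, hcγ⟩ := exists_sub_mem_box hn hγ
    have hmem {z : X} (hz : z ∉ C) : s c +ᵥ z ∈ W := by
      by_contra hzW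
      exact hz (Set.mem_iUnion₂.2 ⟨c, hc, hzW⟩)
    obtain ⟨h, hh, hlt⟩ := hFW _ (hmem hx) _ (hmem hy) (by
      by_contra! hlt
      have := (orbitDist_lt_iff h2ε).1 hlt _ hcγ
      rw [vadd_vadd, vadd_vadd, sub_add_cancel] at this
      exact this.not_ge hγd)
    exact ⟨h.comp (τ c), Finset.mem_union_left _ (Finset.mem_biUnion.2
      ⟨c, hc, Finset.mem_image_of_mem _ hh⟩), hlt⟩

theorem meanWidim_two_mul_le_of_widim_le (hk : 1 ≤ k) (Y : SubAddAction (Fin k → ℤ) X)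
    (hY : IsClosed (Y : Set X)) {m : ℕ} (hm : CoveringDimLE ↥((Y : Set X)ᶜ) m) {ε : ℝ}
    (hε : 0 < ε) {n : ℕ} (hn : 0 < n) :
    meanWidim k X (2 * ε) ≤ ((widim Y (orbitDist (box k n)) ε : ℕ∞) : ℝ≥0∞) / (n : ℝ≥0∞) ^ k +
      ENNReal.ofReal ((1 / (n : ℝ)) ^ k) := by
  have hn' : (0 : ℝ) < n := by exact_mod_cast hn
  generalize hw : widim Y (orbitDist (box k n)) ε = w
  induction w using ENat.recTopCoe with
  | top =>
    rw [ENat.toENNReal_top, ENNReal.top_div_of_ne_top (by simp), top_add]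
    exact le_top
  | coe D =>
    have hlim : Tendsto (fun N : ℕ => ENNReal.ofReal
        ((1 / (n : ℝ) + 1 / N) ^ k * (D + 1) + (1 / (N : ℝ)) ^ k * (m + 1))) atTop
        (𝓝 (ENNReal.ofReal ((1 / (n : ℝ) + 0) ^ k * (D + 1) + 0 ^ k * (m + 1)))) := by
      have h := tendsto_one_div_atTop_nhds_zero_nat (𝕜 := ℝ)
      exact ENNReal.tendsto_ofReal ((((tendsto_const_nhds.add h).pow k).mul_const _).add
        ((h.pow k).mul_const _))
    calc meanWidim k X (2 * ε) ≤ limsup (fun N : ℕ => ENNReal.ofReal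
          ((1 / (n : ℝ) + 1 / N) ^ k * (D + 1) + (1 / (N : ℝ)) ^ k * (m + 1))) atTop := by
          refine limsup_le_limsup ?_
          filter_upwards [eventually_gt_atTop 0] with N hN
          refine le_trans (ENNReal.div_le_div_right ?_ _) (natCast_div_pow_le_ofReal hN)
          rw [← ENat.toENNReal_coe]
          exact ENat.toENNReal_le.2 (widim_box_le Y hY hm hε hn hw.le N)
      _ = ENNReal.ofReal (D / (n : ℝ) ^ k + (1 / (n : ℝ)) ^ k) := by
          rw [hlim.limsup_eq, zero_pow (by omega)]
          congr 1
          rw [add_zero, zero_mul, add_zero, one_div, inv_pow]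
          ring
      _ = _ := by
          rw [ENNReal.ofReal_add (by positivity) (by positivity),
            ENNReal.ofReal_div_of_pos (by positivity), ENNReal.ofReal_pow hn'.le,
            ENNReal.ofReal_natCast, ENNReal.ofReal_natCast, ENat.toENNReal_coe]

theorem meanWidim_two_mul_le (hk : 1 ≤ k) (Y : SubAddAction (Fin k → ℤ) X)
    (hY : IsClosed (Y : Set X)) {m : ℕ} (hm : CoveringDimLE ↥((Y : Set X)ᶜ) m) {ε : ℝ}
    (hε : 0 < ε) : meanWidim k X (2 * ε) ≤ meanWidim k Y ε := by
  have h0 : Tendsto (fun n : ℕ => ENNReal.ofReal ((1 / (n : ℝ)) ^ k)) atTop (𝓝 0) := by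
    have := ENNReal.tendsto_ofReal ((tendsto_one_div_atTop_nhds_zero_nat (𝕜 := ℝ)).pow k)
    rwa [zero_pow (by omega), ENNReal.ofReal_zero] at this
  calc meanWidim k X (2 * ε) = limsup (fun _ : ℕ => meanWidim k X (2 * ε)) atTop :=
        (limsup_const _).symm
    _ ≤ limsup (fun n : ℕ => ((widim Y (orbitDist (box k n)) ε : ℕ∞) : ℝ≥0∞) / (n : ℝ≥0∞) ^ k +
          ENNReal.ofReal ((1 / (n : ℝ)) ^ k)) atTop := by
        refine limsup_le_limsup ?_
        filter_upwards [eventually_gt_atTop 0] with n hn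
        exact meanWidim_two_mul_le_of_widim_le hk Y hY hm hε hn
    _ = meanWidim k Y ε := ENNReal.limsup_add_of_right_tendsto_zero h0 _

end

end MeanDimension

theorem mainTheorem8 (k : ℕ) (hk : 1 ≤ k)
    (X : Type*) [MetricSpace X] [CompactSpace X]
    [AddAction (Fin k → ℤ) X] [ContinuousConstVAdd (Fin k → ℤ) X]
    (Y : SubAddAction (Fin k → ℤ) X) (hY : IsClosed (Y : Set X))
    (hdim : MeanDimension.HasFiniteCoveringDim ↥((Y : Set X)ᶜ)) :
    MeanDimension.meanDim k X = MeanDimension.meanDim k Y := by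
  obtain ⟨m, hm⟩ := hdim
  refine le_antisymm (iSup₂_le fun ε hε => ?_) (iSup₂_mono fun ε _ =>
    MeanDimension.meanWidim_subAddAction_le Y ε)
  calc MeanDimension.meanWidim k X ε = MeanDimension.meanWidim k X (2 * (ε / 2)) := by
        rw [mul_div_cancel₀ ε two_ne_zero]
    _ ≤ MeanDimension.meanWidim k Y (ε / 2) :=
        MeanDimension.meanWidim_two_mul_le hk Y hY hm (half_pos hε)
    _ ≤ MeanDimension.meanDim k Y :=
        le_iSup₂ (f := fun (ε : ℝ) (_ : 0 < ε) => MeanDimension.meanWidim k Y ε) _ (half_pos hε)
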